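/- Let $N\ge 2$, $K\ge 1$, and let $\mathcal X$ be a finite alphabet with $|\mathcal X|\ge 2$. An $(N,K)$ private information retrieval (PIR) code over $\mathcal X$ consists of the following. - Mutually independent messages $W_1,\dots,W_K$, each made of $L\ge 1$ i.i.d. symbols uniform on $\mathcal X$, and a random key $\mathbf F$ independent of $W_{1:K}$. - Stored contents $S_n\in\mathcal S_n$, $n=1,\dots,N$, with $\mathcal S_n$ finite, each a function of $W_{1:K}$. - For each requested index $k$, queries $Q^{[k]}_n\in\mathcal Q_n$, with $\mathcal Q_n$ discrete (countable), which are functions of $\mathbf F$. - Answers $A^{[k]}_n\in\mathcal Y^{\ell_n}$ over a finite alphabet $\mathcal Y$, where the length $\ell_n=\ell_n(Q^{[k]}_n)$ is a function of the query and has finite expectation, and $A^{[k]}_n$ is a function of $Q^{[k]}_n$ and $S_n$. Neither function depends on $k$. It is required that, for every $k$, the message $W_k$ is almost surely determined by $A^{[k]}_{1:N}$ and $Q^{[k]}_{1:N}$, and that, for every $n$ and $q\in\mathcal Q_n$, the probability $\Pr(Q^{[k]}_n=q)$ does not depend on $k$. The storage cost and the download cost of the code are $$\bar\alpha=\frac1{NL}\sum_{n=1}^N\log_{|\mathcal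 X|}|\mathcal S_n|,\qquad \bar\beta=\frac{\log_{|\mathcal X|}|\mathcal Y|}{NL}\sum_{n=1}^N\mathbb E(\ell_n)$$ (the latter does not depend on $k$, by privacy). A pair $(\alpha,\beta)\in\mathbb R^2$ is achievable if some such code has $\bar\alpha\le\alpha$ and $\bar\beta\le\beta$. Put $$\alpha_0=\frac KN,\qquad \beta_0=\frac1N+\frac1{N^2}+\dots+\frac1{N^K}.$$ (i) The point $(2\alpha_0,2\beta_0)$ is achievable. (ii) Conversely, every achievable $(\alpha,\beta)$ satisfies $\alpha\ge\alpha_0$ and $\beta\ge\beta_0$. Consequently the tradeoff is approximated within a factor of 2 in each of three regimes: (iii) for every $\beta\ge2\beta_0$, $\ \alpha_0\le\inf\{\alpha:(\alpha,\beta)\text{ achievable}\}\le2\alpha_0$; (iv) for every $\alpha\ge2\alpha_0$, $\ \beta_0\le\inf\{\beta:(\alpha,\beta)\text{ achievable}\}\le2\beta_0$; (v) $\alpha_0+\beta_0\le\inf\{\alpha+\beta:(\alpha,\beta)\text{ achievable},\ \alpha\le2\alpha_0,\ \beta\le2\beta_0\}\le2\alpha_0+2\beta_0$. -/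

import Mathlib

open MeasureTheory ProbabilityTheory

/-- A private information retrieval code for `N` servers and `K` messages whose symbols lie in the
alphabet `X`. -/
structure PIRCode (N K : ℕ) (X : Type) [MeasurableSpace X] where
  /-- number of symbols per message -/
  L : ℕ
  L_pos : 0 < L
  /-- the underlying probability space -/
  Ω : Type
  [measurableSpaceΩ : MeasurableSpace Ω]
  P : Measure Ω
  [isProbabilityMeasure : IsProbabilityMeasure P]
  /-- `W k l` is the `l`-th symbol of message `k` -/
  W : Fin K → Fin L → Ω → X
  measurable_W : ∀ k l, Measurable (W k l)
  /-- every symbol is uniformly distributed -/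
  uniform_W : ∀ k l x, P (W k l ⁻¹' {x}) = (Nat.card X : ENNReal)⁻¹
  /-- the symbols of one message are independent -/
  indep_symbols : ∀ k, iIndepFun (fun l => W k l) P
  /-- the messages are mutually independent -/
  indep_messages : iIndepFun (fun k ω l => W k l ω) P
  /-- values of the random key -/
  Key : Type
  [measurableSpaceKey : MeasurableSpace Key]
  /-- the random key -/
  F : Ω → Key
  measurable_F : Measurable F
  /-- the key is independent of all the messages -/
  indep_key : IndepFun F (fun ω k l => W k l ω) P
  /-- the storage alphabet of each server -/
  S : Fin N → Type
  [finite_S : ∀ n, Finite (S n)]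
  /-- the stored content is a function of the messages -/
  store : ∀ n, (Fin K → Fin L → X) → S n
  /-- the (discrete) query alphabet of each server -/
  Q : Fin N → Type
  [countable_Q : ∀ n, Countable (Q n)]
  /-- `query k n` turns the key into the query sent to server `n` when message `k` is requested -/
  query : Fin K → ∀ n, Key → Q n
  measurable_query : ∀ k n q, MeasurableSet (query k n ⁻¹' {q})
  /-- the answer alphabet -/
  Y : Type
  [finite_Y : Finite Y]
  /-- the length of the answer of server `n` to a query -/
  len : ∀ n, Q n → ℕ
  /-- the answer is a function of the query and of the stored content; the server does not know
  which message is requested, so neither this function nor the length depends on it -/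
  answer : ∀ n (q : Q n), S n → (Fin (len n q) → Y)
  /-- the user, who wants message `k`, decodes from all the queries and answers -/
  decode : Fin K → (∀ n, (q : Q n) × (Fin (len n q) → Y)) → (Fin L → X)
  /-- the requested message is recovered almost surely -/
  correct : ∀ k, ∀ᵐ ω ∂P,
    decode k (fun n => ⟨query k n (F ω),
      answer n (query k n (F ω)) (store n (fun j l => W j l ω))⟩) = fun l => W k l ω
  /-- the law of the query to any one server does not depend on the requested message -/
  privacy : ∀ n k k' q,
    P {ω | query k n (F ω) = q} = P {ω | query k' n (F ω) = q}
  /-- answer lengths have finite expectation -/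
  integrable_len : ∀ k n, Integrable (fun ω => (len n (query k n (F ω)) : ℝ)) P

attribute [instance] PIRCode.measurableSpaceΩ PIRCode.isProbabilityMeasure
  PIRCode.measurableSpaceKey PIRCode.finite_S PIRCode.countable_Q PIRCode.finite_Y

namespace PIRCode

variable {N K : ℕ} {X : Type} [MeasurableSpace X]

/-- Normalized average storage cost `(1 / (N L)) ∑ₙ log_|X| |Sₙ|`. -/
noncomputable def storageCost (C : PIRCode N K X) : ℝ :=
  1 / ((N : ℝ) * C.L) * ∑ n, Real.logb (Nat.card X) (Nat.card (C.S n))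

/-- Normalized average download cost `(log_|X| |Y| / (N L)) ∑ₙ E(ℓₙ)` when message `k` is
requested; by privacy it has the same value for all `k`. -/
noncomputable def downloadCost (C : PIRCode N K X) (k : Fin K) : ℝ :=
  Real.logb (Nat.card X) (Nat.card C.Y) / ((N : ℝ) * C.L) *
    ∑ n, ∫ ω, (C.len n (C.query k n (C.F ω)) : ℝ) ∂C.P

/-- The download cost does not depend on the requested message. -/
theorem downloadCost_eq (C : PIRCode N K X) (k k' : Fin K) :
    C.downloadCost k = C.downloadCost k' := by
  unfold PIRCode.downloadCost
  congr 1
  refine Finset.sum_congr rfl fun n _ => ?_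
  let _ : MeasurableSpace (C.Q n) := ⊤
  have hm : ∀ k, Measurable fun ω => C.query k n (C.F ω) := fun k =>
    measurable_to_countable' fun q => C.measurable_F (C.measurable_query k n q)
  have hlaw : C.P.map (fun ω => C.query k n (C.F ω)) =
      C.P.map (fun ω => C.query k' n (C.F ω)) := by
    refine Measure.ext_of_singleton fun q => ?_
    rw [Measure.map_apply (hm k) trivial, Measure.map_apply (hm k') trivial]
    exact C.privacy n k k' q
  rw [← integral_map (φ := fun ω => C.query k n (C.F ω)) (f := fun q => (C.len n q : ℝ))
      (hm k).aemeasurable measurable_from_top.aestronglyMeasurable, hlaw,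
    integral_map (hm k').aemeasurable measurable_from_top.aestronglyMeasurable]

end PIRCode

/-- The point `(α, β)` is achievable with `N` servers and `K` messages over the alphabet `X`. -/
def PIRAchievable (N K : ℕ) (X : Type) [MeasurableSpace X] (α β : ℝ) : Prop :=
  ∃ C : PIRCode N K X, C.storageCost ≤ α ∧ ∀ k, C.downloadCost k ≤ β

/-- The optimal storage cost for a given download cost. -/
noncomputable def pirAlphaMin (N K : ℕ) (X : Type) [MeasurableSpace X] (β : ℝ) : ℝ :=
  sInf {α | PIRAchievable N K X α β}

/-- The optimal download cost for a given storage cost. -/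
noncomputable def pirBetaMin (N K : ℕ) (X : Type) [MeasurableSpace X] (α : ℝ) : ℝ :=
  sInf {β | PIRAchievable N K X α β}

/-- `α₀ = K / N`. -/
noncomputable def pirAlpha0 (N K : ℕ) : ℝ := (K : ℝ) / N

/-- `β₀ = 1 / N + 1 / N ^ 2 + ⋯ + 1 / N ^ K`. -/
noncomputable def pirBeta0 (N K : ℕ) : ℝ := ∑ i ∈ Finset.Icc 1 K, 1 / (N : ℝ) ^ i

/-! Storage converse: for almost every key, decoding succeeds for all message values, so the stored
contents determine the messages and |X|^(KL) ≤ ∏|Sₙ|. Download converse: let T_m be the sum over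
servers of the expected entropy of the answer given the first m messages. Subadditivity,
decodability of message m (counted from 0) and averaging over servers give T_m ≥ L log|X| +
T_(m+1)/N when message m is requested (`expectedEntropy_step`). Each term of T_m involves a single
query, so privacy makes T_m independent of the request and the inequalities chain; T_0 is at most
log|Y| times the total expected length. Entropy here is counting over the finite set of message
values with the key held fixed. Achievability: `pairCode` splits each message into N symbols,
replicates each on two cyclically adjacent servers, and runs a two-server scheme on each pair. This
costs twice α₀ in storage, and 2/N ≤ 2β₀ in download. -/

section Entropy

/-! ### Entropy of functions on a finite uniform space. -/

variable {Ω A B C : Type*} [Fintype Ω]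

open Classical in
/-- The number of points in the fiber of `f` through `ω`. -/
noncomputable def fiberCard (f : Ω → A) (ω : Ω) : ℕ :=
  (Finset.univ.filter fun ω' => f ω' = f ω).card

/-- The Shannon entropy (in nats) of `f` under the uniform distribution on its finite domain. -/
noncomputable def uniformEntropy (f : Ω → A) : ℝ :=
  Real.log (Fintype.card Ω) - (∑ ω, Real.log (fiberCard f ω)) / Fintype.card Ω

theorem fiberCard_pos (f : Ω → A) (ω : Ω) : 0 < fiberCard f ω := by
  classical
  exact Finset.card_pos.mpr ⟨ω, by simp⟩

theorem fiberCard_congr (f : Ω → A) {ω ω' : Ω} (h : f ω = f ω') :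
    fiberCard f ω = fiberCard f ω' := by
  unfold fiberCard
  rw [h]

theorem fiberCard_le_card (f : Ω → A) (ω : Ω) : fiberCard f ω ≤ Fintype.card Ω := by
  classical
  exact Finset.card_le_univ _

theorem fiberCard_anti (f : Ω → A) (g : Ω → B) (h : ∀ ω ω', g ω = g ω' → f ω = f ω') (ω : Ω) :
    fiberCard g ω ≤ fiberCard f ω := by
  classical
  refine Finset.card_le_card fun ω' => ?_
  simpa using h ω' ω

theorem fiberCard_eq_sum [DecidableEq A] (f : Ω → A) (ω : Ω) :
    (fiberCard f ω : ℝ) = ∑ ω', if f ω' = f ω then 1 else 0 := by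
  classical
  rw [Finset.sum_boole, fiberCard]
  congr!

/-- A nonempty fiber of size c contributes c · (1/c) = 1, an empty one 0. -/
theorem sum_inv_fiberCard_le [DecidableEq A] (f : Ω → A) (a : A) :
    ∑ ω, (if f ω = a then (fiberCard f ω : ℝ)⁻¹ else 0) ≤ 1 := by
  classical
  by_cases h : ∃ ω₀, f ω₀ = a
  · obtain ⟨ω₀, rfl⟩ := h
    have : ∀ ω, (if f ω = f ω₀ then (fiberCard f ω : ℝ)⁻¹ else 0) =
        (if f ω = f ω₀ then 1 else 0) * (fiberCard f ω₀ : ℝ)⁻¹ := by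
      intro ω
      split_ifs with h
      · rw [fiberCard_congr f h, one_mul]
      · simp
    simp_rw [this]
    rw [← Finset.sum_mul, ← fiberCard_eq_sum]
    exact mul_inv_le_one
  · push Not at h
    simp [h]

theorem uniformEntropy_mono (f : Ω → A) (g : Ω → B)
    (h : ∀ ω ω', g ω = g ω' → f ω = f ω') : uniformEntropy f ≤ uniformEntropy g := by
  unfold uniformEntropy
  gcongr with ω
  · exact_mod_cast fiberCard_pos g ω
  · exact fiberCard_anti f g h ω

/-- Average log x ≤ x - 1 at x = n / (t c(ω)), with c the fiber size, n = |Ω| and t = |A|: the sum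
of 1/c(ω) counts the values taken, so x has mean at most 1. -/
theorem uniformEntropy_le_log_card [Finite A] [Nonempty Ω] (f : Ω → A) :
    uniformEntropy f ≤ Real.log (Nat.card A) := by
  classical
  have := Fintype.ofFinite A
  have hA : Nonempty A := ‹Nonempty Ω›.map f
  rw [Nat.card_eq_fintype_card]
  have hn : (0 : ℝ) < Fintype.card Ω := by exact_mod_cast Fintype.card_pos
  have ha : (0 : ℝ) < Fintype.card A := by exact_mod_cast Fintype.card_pos
  set n := (Fintype.card Ω : ℝ)
  set t := (Fintype.card A : ℝ)
  have key : ∑ ω, (fiberCard f ω : ℝ)⁻¹ ≤ t := by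
    calc ∑ ω, (fiberCard f ω : ℝ)⁻¹
        = ∑ a, ∑ ω, (if f ω = a then (fiberCard f ω : ℝ)⁻¹ else 0) := by
          rw [Finset.sum_comm]
          simp
      _ ≤ ∑ _a : A, 1 := Finset.sum_le_sum fun a _ => sum_inv_fiberCard_le f a
      _ = t := by simp [t]
  have h1 : ∀ ω, Real.log n - Real.log t - n / t * (fiberCard f ω : ℝ)⁻¹ + 1 ≤
      Real.log (fiberCard f ω) := by
    intro ω
    have hc : (0 : ℝ) < fiberCard f ω := by exact_mod_cast fiberCard_pos f ω
    have := Real.log_le_sub_one_of_pos (x := n / t * (fiberCard f ω : ℝ)⁻¹) (by positivity)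
    rw [Real.log_mul (by positivity) (by positivity), Real.log_div hn.ne' ha.ne',
      Real.log_inv] at this
    linarith
  have h2 := Finset.sum_le_sum fun ω (_ : ω ∈ Finset.univ) => h1 ω
  rw [Finset.sum_add_distrib, Finset.sum_sub_distrib, ← Finset.mul_sum, Finset.sum_const,
    Finset.sum_const, Finset.card_univ, nsmul_eq_mul, nsmul_eq_mul] at h2
  have h3 : n / t * ∑ ω, (fiberCard f ω : ℝ)⁻¹ ≤ n := by
    calc _ ≤ n / t * t := by gcongr
      _ = n := by field_simp
  unfold uniformEntropy
  rw [sub_le_comm, le_div_iff₀ hn]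
  change n * _ - _ + n * 1 ≤ _ at h2
  linarith

theorem uniformEntropy_nonneg (f : Ω → A) : 0 ≤ uniformEntropy f := by
  unfold uniformEntropy
  rcases isEmpty_or_nonempty Ω with h | h
  · simp
  have hn : (0 : ℝ) < Fintype.card Ω := by exact_mod_cast Fintype.card_pos
  rw [sub_nonneg, div_le_iff₀ hn]
  calc ∑ ω, Real.log (fiberCard f ω) ≤ ∑ _ω : Ω, Real.log (Fintype.card Ω) := by
        gcongr with ω
        · exact_mod_cast fiberCard_pos f ω
        · exact fiberCard_le_card f ω
    _ = _ := by simp [mul_comm]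

theorem uniformEntropy_le_log_card_domain (f : Ω → A) :
    uniformEntropy f ≤ Real.log (Fintype.card Ω) := by
  unfold uniformEntropy
  refine sub_le_self _ (div_nonneg (Finset.sum_nonneg fun ω _ => ?_) (Nat.cast_nonneg _))
  exact Real.log_natCast_nonneg _

/-- Average log x ≤ x - 1 at x = c₁c₂ / (c c_z), a ratio of fiber sizes. That x has mean at most 1
follows by reading c₁c₂ as a number of pairs (ω₁, ω₂) and summing over ω first. -/
theorem uniformEntropy_submodular (a : Ω → A) (b : Ω → B) (z : Ω → C) :
    uniformEntropy (fun ω => (a ω, b ω, z ω)) + uniformEntropy z ≤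
      uniformEntropy (fun ω => (a ω, z ω)) + uniformEntropy (fun ω => (b ω, z ω)) := by
  classical
  rcases isEmpty_or_nonempty Ω with h | h
  · simp [uniformEntropy]
  have hn : (0 : ℝ) < Fintype.card Ω := by exact_mod_cast Fintype.card_pos
  set f : Ω → A × B × C := fun ω => (a ω, b ω, z ω)
  set f₁ : Ω → A × C := fun ω => (a ω, z ω)
  set f₂ : Ω → B × C := fun ω => (b ω, z ω)
  have key : ∑ ω, (fiberCard f₁ ω : ℝ) * fiberCard f₂ ω *
      ((fiberCard f ω : ℝ)⁻¹ * (fiberCard z ω : ℝ)⁻¹) ≤ Fintype.card Ω := by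
    calc _ = ∑ ω, ∑ ω₁, ∑ ω₂, (if f₁ ω₁ = f₁ ω then 1 else 0) * (if f₂ ω₂ = f₂ ω then 1 else 0) *
            ((fiberCard f ω : ℝ)⁻¹ * (fiberCard z ω : ℝ)⁻¹) := by
          refine Finset.sum_congr rfl fun ω _ => ?_
          rw [fiberCard_eq_sum f₁, fiberCard_eq_sum f₂, Finset.sum_mul_sum, Finset.sum_mul]
          simp_rw [Finset.sum_mul]
      _ = ∑ ω₁, ∑ ω₂, ∑ ω, (if f₁ ω₁ = f₁ ω then 1 else 0) * (if f₂ ω₂ = f₂ ω then 1 else 0) *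
            ((fiberCard f ω : ℝ)⁻¹ * (fiberCard z ω : ℝ)⁻¹) := by
          rw [Finset.sum_comm]
          refine Finset.sum_congr rfl fun ω₁ _ => ?_
          rw [Finset.sum_comm]
      -- For a fixed pair, the admissible ω form one fiber of `f`, and exist only if `z` agrees on
      -- the pair.
      _ = ∑ ω₁, ∑ ω₂, ((if z ω₂ = z ω₁ then 1 else 0) * (fiberCard z ω₁ : ℝ)⁻¹) *
            ∑ ω, (if f ω = (a ω₁, b ω₂, z ω₁) then (fiberCard f ω : ℝ)⁻¹ else 0) := by
          refine Finset.sum_congr rfl fun ω₁ _ => Finset.sum_congr rfl fun ω₂ _ => ?_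
          rw [Finset.mul_sum]
          refine Finset.sum_congr rfl fun ω _ => ?_
          by_cases hz : z ω = z ω₁
          · rw [fiberCard_congr z hz]
            simp only [f, f₁, f₂, Prod.mk.injEq, hz, eq_comm (a := a ω), eq_comm (a := b ω)]
            by_cases h1 : a ω₁ = a ω <;> by_cases h2 : b ω₂ = b ω <;>
              by_cases h3 : z ω₂ = z ω₁ <;> simp [h1, h2, h3]
            ring
          · have hz' : ¬ z ω₁ = z ω := fun h => hz h.symm
            simp [f, f₁, hz, hz']
      _ ≤ ∑ ω₁, ∑ ω₂, ((if z ω₂ = z ω₁ then 1 else 0) * (fiberCard z ω₁ : ℝ)⁻¹) * 1 := by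
          gcongr with ω₁ _ ω₂ _
          exact sum_inv_fiberCard_le f _
      _ = ∑ ω₁ : Ω, 1 := by
          refine Finset.sum_congr rfl fun ω₁ _ => ?_
          simp_rw [mul_one]
          rw [← Finset.sum_mul, ← fiberCard_eq_sum]
          exact mul_inv_cancel₀ (by exact_mod_cast (fiberCard_pos z ω₁).ne')
      _ = Fintype.card Ω := by simp
  have h1 : ∀ ω, Real.log (fiberCard f₁ ω) + Real.log (fiberCard f₂ ω) -
      Real.log (fiberCard f ω) - Real.log (fiberCard z ω) ≤ (fiberCard f₁ ω : ℝ) * fiberCard f₂ ω *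
      ((fiberCard f ω : ℝ)⁻¹ * (fiberCard z ω : ℝ)⁻¹) - 1 := by
    intro ω
    have c1 : (0 : ℝ) < fiberCard f₁ ω := by exact_mod_cast fiberCard_pos f₁ ω
    have c2 : (0 : ℝ) < fiberCard f₂ ω := by exact_mod_cast fiberCard_pos f₂ ω
    have c3 : (0 : ℝ) < fiberCard f ω := by exact_mod_cast fiberCard_pos f ω
    have c4 : (0 : ℝ) < fiberCard z ω := by exact_mod_cast fiberCard_pos z ω
    have := Real.log_le_sub_one_of_pos (x := (fiberCard f₁ ω : ℝ) * fiberCard f₂ ω *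
      ((fiberCard f ω : ℝ)⁻¹ * (fiberCard z ω : ℝ)⁻¹)) (by positivity)
    rw [Real.log_mul (by positivity) (by positivity), Real.log_mul c1.ne' c2.ne',
      Real.log_mul (by positivity) (by positivity), Real.log_inv, Real.log_inv] at this
    linarith
  have h2 := Finset.sum_le_sum fun ω (_ : ω ∈ Finset.univ) => h1 ω
  simp only [Finset.sum_add_distrib, Finset.sum_sub_distrib] at h2
  have h3 : ∑ _ω : Ω, (1 : ℝ) = Fintype.card Ω := by simp
  have h4 : (∑ ω, Real.log (fiberCard f₁ ω) + ∑ ω, Real.log (fiberCard f₂ ω)) / Fintype.card Ω ≤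
      (∑ ω, Real.log (fiberCard f ω) + ∑ ω, Real.log (fiberCard z ω)) / Fintype.card Ω := by
    gcongr ?_ / _
    linarith
  rw [add_div, add_div] at h4
  unfold uniformEntropy
  linarith

/-- Conditional entropy is subadditive. -/
theorem uniformEntropy_subadditive {ι : Type*} [Fintype ι] {D : ι → Type*} (a : ∀ i, Ω → D i)
    (z : Ω → C) :
    uniformEntropy (fun ω => (fun i => a i ω, z ω)) - uniformEntropy z ≤
      ∑ i, (uniformEntropy (fun ω => (a i ω, z ω)) - uniformEntropy z) := by
  classical
  have main : ∀ s : Finset ι,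
      uniformEntropy (fun ω => (fun i : s => a i ω, z ω)) - uniformEntropy z ≤
        ∑ i ∈ s, (uniformEntropy (fun ω => (a i ω, z ω)) - uniformEntropy z) := by
    intro s
    induction s using Finset.induction_on with
    | empty =>
      rw [Finset.sum_empty, sub_nonpos]
      refine uniformEntropy_mono _ _ fun ω ω' h => ?_
      simp only [Prod.mk.injEq]
      exact ⟨funext fun i => absurd i.2 (Finset.notMem_empty _), h⟩
    | insert i s hi ih =>
      rw [Finset.sum_insert hi]
      have h1 := uniformEntropy_submodular (a i) (fun ω => fun j : s => a j ω) z
      have h2 : uniformEntropy (fun ω => (fun j : (insert i s : Finset ι) => a j ω, z ω)) ≤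
          uniformEntropy (fun ω => (a i ω, (fun j : s => a j ω), z ω)) := by
        refine uniformEntropy_mono _ _ fun ω ω' h => ?_
        simp only [Prod.mk.injEq, funext_iff, Subtype.forall, Finset.mem_insert,
          forall_eq_or_imp] at h ⊢
        exact ⟨⟨h.1, h.2.1⟩, h.2.2⟩
      linarith
  have h := main Finset.univ
  refine le_trans (sub_le_sub_right (uniformEntropy_mono _ _ fun ω ω' h => ?_) _) h
  simp only [Prod.mk.injEq, funext_iff, Subtype.forall, Finset.mem_univ, true_imp_iff] at h ⊢
  exact h

/-- The restriction of a family to the indices below `m`. -/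
def initialPart {K : ℕ} {V : Type*} (m : ℕ) (w : Fin K → V) (j : {j : Fin K // j.1 < m}) : V :=
  w j

theorem fiberCard_initialPart {K : ℕ} {V : Type*} [Fintype V] (m : ℕ) (w : Fin K → V) :
    fiberCard (initialPart m) w =
      Fintype.card V ^ (Finset.univ.filter fun j : Fin K => ¬ j.1 < m).card := by
  classical
  have : (Finset.univ.filter fun w' => initialPart m w' = initialPart m w) =
      Fintype.piFinset fun j : Fin K => if j.1 < m then {w j} else Finset.univ := by
    ext w'
    simp only [Finset.mem_filter, Finset.mem_univ, true_and, Fintype.mem_piFinset, funext_iff,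
      Subtype.forall, initialPart]
    refine forall_congr' fun j => ?_
    split_ifs with h <;> simp [h]
  refine Eq.trans (by rw [fiberCard]; congr!) ((congrArg Finset.card this).trans ?_)
  rw [Fintype.card_piFinset, Finset.card_eq_sum_ones, ← Finset.prod_pow_eq_pow_sum,
    Finset.prod_filter]
  refine Finset.prod_congr rfl fun j _ => ?_
  split_ifs <;> simp_all

/-- Fixing one more message divides every fiber by |V|. -/
theorem uniformEntropy_initialPart_succ {K : ℕ} {V : Type*} [Fintype V] [Nonempty V] {m : ℕ}
    (hm : m < K) :
    uniformEntropy (initialPart (K := K) (V := V) (m + 1)) =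
      uniformEntropy (initialPart (K := K) (V := V) m) + Real.log (Fintype.card V) := by
  have hs : (Finset.univ.filter fun j : Fin K => ¬ j.1 < m) =
      insert ⟨m, hm⟩ (Finset.univ.filter fun j : Fin K => ¬ j.1 < m + 1) := by
    ext j
    simp only [Finset.mem_filter, Finset.mem_univ, true_and, Finset.mem_insert, Fin.ext_iff]
    omega
  have hV : (Fintype.card V : ℝ) ≠ 0 := by exact_mod_cast Fintype.card_ne_zero
  have hn : (Fintype.card (Fin K → V) : ℝ) ≠ 0 := by exact_mod_cast Fintype.card_ne_zero
  have h : ∀ w : Fin K → V, Real.log (fiberCard (initialPart m) w) =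
      Real.log (fiberCard (initialPart (m + 1)) w) + Real.log (Fintype.card V) := by
    intro w
    rw [fiberCard_initialPart, fiberCard_initialPart, hs, Finset.card_insert_of_notMem (by simp),
      pow_succ, Nat.cast_mul, Real.log_mul (by simp) hV]
  unfold uniformEntropy
  simp_rw [h]
  rw [Finset.sum_add_distrib, add_div, Finset.sum_const, Finset.card_univ, nsmul_eq_mul,
    mul_div_cancel_left₀ _ hn]
  ring

end Entropy

/-! ### Converse: good keys, privacy and the storage bound. -/

namespace PIRCode

variable {N K : ℕ} {X : Type} [MeasurableSpace X]

/-- The answer of server `n` to the query `q` as a function of the messages. -/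
def answerOf (C : PIRCode N K X) (n : Fin N) (q : C.Q n) (w : Fin K → Fin C.L → X) :
    Fin (C.len n q) → C.Y :=
  C.answer n q (C.store n w)

/-- A value of the key for which decoding succeeds for all values of the messages. -/
def GoodKey (C : PIRCode N K X) (f : C.Key) : Prop :=
  ∀ k w, C.decode k (fun n => ⟨C.query k n f, C.answerOf n (C.query k n f) w⟩) = w k

theorem measure_messages_eq [MeasurableSingletonClass X] (C : PIRCode N K X)
    (w : Fin K → Fin C.L → X) :
    C.P ((fun ω k l => C.W k l ω) ⁻¹' {w}) = ∏ _k : Fin K, ∏ _l : Fin C.L,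
      (Nat.card X : ENNReal)⁻¹ := by
  have h1 : (fun ω k l => C.W k l ω) ⁻¹' {w} =
      ⋂ k ∈ Finset.univ, (fun ω l => C.W k l ω) ⁻¹' {w k} := by
    ext ω
    simp [funext_iff]
  rw [h1, C.indep_messages.measure_inter_preimage_eq_mul _ fun _ _ => measurableSet_singleton _]
  refine Finset.prod_congr rfl fun k _ => ?_
  have h2 : (fun ω l => C.W k l ω) ⁻¹' {w k} = ⋂ l ∈ Finset.univ, C.W k l ⁻¹' {w k l} := by
    ext ω
    simp [funext_iff]
  rw [h2, (C.indep_symbols k).measure_inter_preimage_eq_mul _ fun _ _ => measurableSet_singleton _]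
  exact Finset.prod_congr rfl fun l _ => C.uniform_W k l _

/-- Each message value has positive probability and is independent of the key, so the keys that fail
for it form a null set; there are finitely many pairs (k, w). -/
theorem ae_goodKey [Finite X] [MeasurableSingletonClass X] (C : PIRCode N K X) :
    ∀ᵐ ω ∂C.P, C.GoodKey (C.F ω) := by
  unfold GoodKey
  rw [ae_all_iff]
  intro k
  rw [ae_all_iff]
  intro w
  set bad : Set C.Key :=
    {f | C.decode k (fun n => ⟨C.query k n f, C.answerOf n (C.query k n f) w⟩) ≠ w k}
  have hbad : MeasurableSet bad := by
    let _ : ∀ n, MeasurableSpace (C.Q n) := fun _ => ⊤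
    have hq : Measurable fun f n => C.query k n f :=
      measurable_pi_lambda _ fun n => measurable_to_countable' fun q => C.measurable_query k n q
    -- `decode` carries no measurability, but failure depends on the key only through the query
    -- tuple, which lives in a countable discrete space.
    exact hq (MeasurableSet.of_discrete
      (s := {q | C.decode k (fun n => ⟨q n, C.answerOf n (q n) w⟩) ≠ w k}))
  have h := C.indep_key.measure_inter_preimage_eq_mul bad {w} hbad (measurableSet_singleton w)
  have h0 : C.P (C.F ⁻¹' bad ∩ (fun ω k l => C.W k l ω) ⁻¹' {w}) = 0 := by
    refine measure_mono_null ?_ (ae_iff.mp (C.correct k))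
    rintro ω ⟨h1, h2⟩
    obtain rfl : (fun k l => C.W k l ω) = w := h2
    exact h1
  rw [h0, C.measure_messages_eq w] at h
  rcases mul_eq_zero.mp h.symm with h | h
  · exact ae_iff.mpr h
  · simp at h

theorem integral_query_eq (C : PIRCode N K X) (n : Fin N) (k k' : Fin K) (φ : C.Q n → ℝ) :
    ∫ ω, φ (C.query k n (C.F ω)) ∂C.P = ∫ ω, φ (C.query k' n (C.F ω)) ∂C.P := by
  let _ : MeasurableSpace (C.Q n) := ⊤
  have hm : ∀ k, Measurable fun ω => C.query k n (C.F ω) := fun k =>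
    measurable_to_countable' fun q => C.measurable_F (C.measurable_query k n q)
  have hlaw : C.P.map (fun ω => C.query k n (C.F ω)) =
      C.P.map (fun ω => C.query k' n (C.F ω)) := by
    refine Measure.ext_of_singleton fun q => ?_
    rw [Measure.map_apply (hm k) trivial, Measure.map_apply (hm k') trivial]
    exact C.privacy n k k' q
  rw [← integral_map (φ := fun ω => C.query k n (C.F ω)) (f := φ)
      (hm k).aemeasurable measurable_from_top.aestronglyMeasurable, hlaw,
    integral_map (hm k').aemeasurable measurable_from_top.aestronglyMeasurable]

/-- The stored contents together determine the messages. -/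
theorem card_messages_le [Finite X] [MeasurableSingletonClass X] (C : PIRCode N K X) :
    Nat.card X ^ (K * C.L) ≤ ∏ n, Nat.card (C.S n) := by
  obtain ⟨ω, hω⟩ := C.ae_goodKey.exists
  have hinj : Function.Injective fun (w : Fin K → Fin C.L → X) n => C.store n w := by
    intro w w' h
    funext k
    rw [← hω k w, ← hω k w']
    congr 1
    funext n
    rw [answerOf, answerOf, show C.store n w = C.store n w' from congrFun h n]
  have := Nat.card_le_card_of_injective _ hinj
  rw [Nat.card_pi (β := C.S)] at this
  refine le_trans (le_of_eq ?_) this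
  simp [Nat.card_fun, ← pow_mul, mul_comm]

theorem alpha0_le_storageCost [Finite X] [Nontrivial X] [MeasurableSingletonClass X]
    (C : PIRCode N K X) (hN : 0 < N) : pirAlpha0 N K ≤ C.storageCost := by
  have hX : (1 : ℝ) < Nat.card X := by exact_mod_cast Finite.one_lt_card
  have hL : (0 : ℝ) < C.L := by exact_mod_cast C.L_pos
  have hN' : (0 : ℝ) < N := by exact_mod_cast hN
  have hS : ∀ n, (Nat.card (C.S n) : ℝ) ≠ 0 := fun n => by
    have : Nonempty (C.S n) := ⟨C.store n fun _ _ => Classical.arbitrary X⟩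
    exact_mod_cast Nat.card_pos.ne'
  have h : (K * C.L : ℝ) ≤ ∑ n, Real.logb (Nat.card X) (Nat.card (C.S n)) := by
    have h1 : ((Nat.card X : ℝ)) ^ (K * C.L) ≤ ∏ n, (Nat.card (C.S n) : ℝ) := by
      exact_mod_cast C.card_messages_le
    have h2 := Real.logb_le_logb_of_le hX (by positivity) h1
    rw [Real.logb_pow, Real.logb_self_eq_one hX, mul_one] at h2
    rw [Real.logb_prod _ _ fun n _ => hS n] at h2
    exact_mod_cast h2
  unfold pirAlpha0 storageCost
  calc (K : ℝ) / N = 1 / (N * C.L) * (K * C.L) := by field_simp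
    _ ≤ _ := by gcongr

/-! ### Converse: the download bound. -/

section Download

variable [Fintype X]

/-- The entropy of the answer of server `n` to the query `q`, conditionally on the first `m`
messages. -/
noncomputable def answerEntropy (C : PIRCode N K X) (m : ℕ) (n : Fin N) (q : C.Q n) : ℝ :=
  uniformEntropy (fun w => (C.answerOf n q w, initialPart m w)) -
    uniformEntropy (initialPart (K := K) (V := Fin C.L → X) m)

theorem answerEntropy_nonneg (C : PIRCode N K X) (m : ℕ) (n : Fin N) (q : C.Q n) :
    0 ≤ C.answerEntropy m n q :=
  sub_nonneg.mpr (uniformEntropy_mono _ _ fun _ _ h => (Prod.mk.inj h).2)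

theorem answerEntropy_le (C : PIRCode N K X) (m : ℕ) (n : Fin N) (q : C.Q n) :
    C.answerEntropy m n q ≤ Real.log (Fintype.card (Fin K → Fin C.L → X)) :=
  (sub_le_self _ (uniformEntropy_nonneg _)).trans (uniformEntropy_le_log_card_domain _)

theorem answerEntropy_zero_le [Nonempty X] (C : PIRCode N K X) (n : Fin N) (q : C.Q n) :
    C.answerEntropy 0 n q ≤ C.len n q * Real.log (Nat.card C.Y) := by
  refine (sub_le_self _ (uniformEntropy_nonneg _)).trans ?_
  refine (uniformEntropy_mono _ (C.answerOf n q) fun w w' h => ?_).trans ?_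
  · rw [h, Prod.mk.injEq]
    exact ⟨rfl, funext fun j => absurd j.2 (Nat.not_lt_zero _)⟩
  · refine (uniformEntropy_le_log_card _).trans (le_of_eq ?_)
    rw [Nat.card_fun, Nat.card_fin, Nat.cast_pow, Real.log_pow]

theorem integrable_answerEntropy (C : PIRCode N K X) (m : ℕ) (n : Fin N) (k : Fin K) :
    Integrable (fun ω => C.answerEntropy m n (C.query k n (C.F ω))) C.P := by
  let _ : MeasurableSpace (C.Q n) := ⊤
  have hm : Measurable fun ω => C.query k n (C.F ω) :=
    measurable_to_countable' fun q => C.measurable_F (C.measurable_query k n q)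
  have hm' : Measurable (C.answerEntropy m n) := measurable_from_top
  refine Integrable.of_bound (hm'.comp hm).aestronglyMeasurable
    (Real.log (Fintype.card (Fin K → Fin C.L → X))) (ae_of_all _ fun ω => ?_)
  rw [Real.norm_of_nonneg (C.answerEntropy_nonneg _ _ _)]
  exact C.answerEntropy_le _ _ _

/-- The joint entropy of the answers given the messages before k is at most the sum of the
individual ones. Since the answers reveal message k, it splits off L log|X|; what remains dominates
each individual entropy given one more message, hence their average. -/
theorem sum_answerEntropy_step [Nonempty X] (C : PIRCode N K X) (hN : 0 < N) {f : C.Key}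
    (hf : C.GoodKey f) (k : Fin K) :
    C.L * Real.log (Nat.card X) + 1 / N * ∑ n, C.answerEntropy (k + 1) n (C.query k n f) ≤
      ∑ n, C.answerEntropy k n (C.query k n f) := by
  have hN' : (0 : ℝ) < N := by exact_mod_cast hN
  set joint := fun w n => C.answerOf n (C.query k n f) w
  have hdec : ∀ w w', joint w = joint w' → w k = w' k := fun w w' h => by
    rw [← hf k w, ← hf k w']
    congr 1
    funext n
    rw [show C.answerOf n (C.query k n f) w = _ from congrFun h n]
  have h1 := uniformEntropy_subadditive (fun n => C.answerOf n (C.query k n f))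
    (initialPart (K := K) (V := Fin C.L → X) k)
  have h2 : uniformEntropy (fun w => (joint w, initialPart (k + 1) w)) ≤
      uniformEntropy (fun w => (joint w, initialPart k w)) := by
    refine uniformEntropy_mono _ _ fun w w' h => ?_
    obtain ⟨h, h'⟩ := Prod.mk.inj h
    refine Prod.ext h (funext fun ⟨j, hj⟩ => ?_)
    rcases Nat.lt_succ_iff_lt_or_eq.mp hj with hj | hj
    · exact congrFun h' ⟨j, hj⟩
    · obtain rfl := Fin.ext hj
      exact hdec w w' h
  have h3 : ∀ n, C.answerEntropy (k + 1) n (C.query k n f) ≤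
      uniformEntropy (fun w => (joint w, initialPart (k + 1) w)) -
        uniformEntropy (initialPart (K := K) (V := Fin C.L → X) (k + 1)) := fun n => by
    refine sub_le_sub_right (uniformEntropy_mono _ _ fun w w' h => ?_) _
    obtain ⟨h, h'⟩ := Prod.mk.inj h
    exact Prod.ext (congrFun h n) h'
  have h4 := Finset.sum_le_sum fun n (_ : n ∈ Finset.univ) => h3 n
  rw [Finset.sum_const, Finset.card_univ, Fintype.card_fin, nsmul_eq_mul, mul_comm,
    ← div_le_iff₀ hN'] at h4
  have h5 := uniformEntropy_initialPart_succ (V := Fin C.L → X) k.2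
  have h6 : Real.log (Fintype.card (Fin C.L → X)) = C.L * Real.log (Nat.card X) := by
    rw [Fintype.card_fun, Fintype.card_fin, Nat.card_eq_fintype_card, Nat.cast_pow, Real.log_pow]
  rw [one_div_mul_eq_div]
  unfold answerEntropy at h4 ⊢
  linarith

/-- The expected sum over the servers of the conditional entropies of the answers. -/
noncomputable def expectedEntropy (C : PIRCode N K X) (m : ℕ) (k : Fin K) : ℝ :=
  ∑ n, ∫ ω, C.answerEntropy m n (C.query k n (C.F ω)) ∂C.P

theorem expectedEntropy_eq (C : PIRCode N K X) (m : ℕ) (k k' : Fin K) :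
    C.expectedEntropy m k = C.expectedEntropy m k' :=
  Finset.sum_congr rfl fun n _ => C.integral_query_eq n k k' _

theorem expectedEntropy_step [Nonempty X] [MeasurableSingletonClass X] (C : PIRCode N K X)
    (hN : 0 < N) (k : Fin K) :
    C.L * Real.log (Nat.card X) + 1 / N * C.expectedEntropy (k + 1) k ≤ C.expectedEntropy k k := by
  unfold expectedEntropy
  rw [← integral_finsetSum _ fun n _ => C.integrable_answerEntropy _ n k,
    ← integral_finsetSum _ fun n _ => C.integrable_answerEntropy _ n k,
    ← integral_const_mul]
  have hi : ∀ m, Integrable (fun ω => ∑ n, C.answerEntropy m n (C.query k n (C.F ω))) C.P :=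
    fun m => integrable_finsetSum _ fun n _ => C.integrable_answerEntropy m n k
  calc _ = ∫ ω, (C.L * Real.log (Nat.card X) +
          1 / N * ∑ n, C.answerEntropy (k + 1) n (C.query k n (C.F ω))) ∂C.P := by
        rw [integral_add (integrable_const _) ((hi _).const_mul _)]
        simp
    _ ≤ _ := by
        refine integral_mono_ae ((integrable_const _).add ((hi _).const_mul _)) (hi _) ?_
        filter_upwards [C.ae_goodKey] with ω hω
        exact C.sum_answerEntropy_step hN hω k

theorem le_expectedEntropy_zero [Nonempty X] [MeasurableSingletonClass X] (C : PIRCode N K X)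
    (hN : 0 < N) (k : Fin K) :
    C.L * Real.log (Nat.card X) * ∑ i ∈ Finset.range K, (1 / N : ℝ) ^ i ≤
      C.expectedEntropy 0 k := by
  -- Downward induction on the number of conditioned messages, starting from all K, where
  -- nonnegativity suffices.
  have main : ∀ j ≤ K, C.L * Real.log (Nat.card X) * ∑ i ∈ Finset.range j, (1 / N : ℝ) ^ i ≤
      C.expectedEntropy (K - j) k := by
    intro j
    induction j with
    | zero =>
      intro _
      rw [Finset.sum_range_zero, mul_zero]
      exact Finset.sum_nonneg fun n _ => integral_nonneg fun ω => C.answerEntropy_nonneg _ _ _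
    | succ j ih =>
      intro hj
      have h1 := C.expectedEntropy_step hN ⟨K - (j + 1), by omega⟩
      -- Privacy replaces the request used in this step by the common `k`.
      rw [C.expectedEntropy_eq _ _ k, C.expectedEntropy_eq (K - (j + 1)) _ k] at h1
      rw [show K - (j + 1) + 1 = K - j by omega] at h1
      refine le_trans ?_ h1
      rw [geom_sum_succ, mul_add, mul_one, add_comm, mul_left_comm]
      gcongr
      exact ih (by omega)
  simpa using main K le_rfl

theorem expectedEntropy_zero_le [Nonempty X] (C : PIRCode N K X) (k : Fin K) :
    C.expectedEntropy 0 k ≤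
      Real.log (Nat.card C.Y) * ∑ n, ∫ ω, (C.len n (C.query k n (C.F ω)) : ℝ) ∂C.P := by
  rw [Finset.mul_sum]
  refine Finset.sum_le_sum fun n _ => ?_
  rw [← integral_const_mul]
  refine integral_mono (C.integrable_answerEntropy 0 n k)
    ((C.integrable_len k n).const_mul _) fun ω => ?_
  dsimp only
  rw [mul_comm]
  exact C.answerEntropy_zero_le n _

end Download

theorem beta0_le_downloadCost [Finite X] [Nontrivial X] [MeasurableSingletonClass X]
    (C : PIRCode N K X) (hN : 0 < N) (k : Fin K) : pirBeta0 N K ≤ C.downloadCost k := by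
  have := Fintype.ofFinite X
  have hX : 0 < Real.log (Nat.card X) :=
    Real.log_pos (by exact_mod_cast Finite.one_lt_card)
  have hL : (0 : ℝ) < C.L := by exact_mod_cast C.L_pos
  have hN' : (0 : ℝ) < N := by exact_mod_cast hN
  have h := (C.le_expectedEntropy_zero hN k).trans (C.expectedEntropy_zero_le k)
  have hβ : pirBeta0 N K = 1 / N * ∑ i ∈ Finset.range K, (1 / N : ℝ) ^ i := by
    rw [pirBeta0, Finset.mul_sum, Finset.range_eq_Ico, ← Finset.Ico_add_one_right_eq_Icc,
      ← Finset.sum_Ico_add' _ 0 K 1]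
    refine Finset.sum_congr rfl fun i _ => ?_
    rw [one_div_pow, pow_succ]
    field_simp
  rw [hβ, downloadCost, Real.logb]
  calc _ = 1 / (N * C.L * Real.log (Nat.card X)) *
        (C.L * Real.log (Nat.card X) * ∑ i ∈ Finset.range K, (1 / N : ℝ) ^ i) := by
        field_simp
    _ ≤ _ := mul_le_mul_of_nonneg_left h (by positivity)
    _ = _ := by field_simp

end PIRCode

/-! ### Achievability: the replicated-pair code. -/

section Achievability

variable (X : Type) [Finite X] [Nontrivial X] [MeasurableSpace X] [MeasurableSingletonClass X]

theorem uniformOn_univ_isProbabilityMeasure (Ω : Type*) [Finite Ω] [Nonempty Ω]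
    [MeasurableSpace Ω] [MeasurableSingletonClass Ω] :
    IsProbabilityMeasure (uniformOn (Set.univ : Set Ω)) :=
  isProbabilityMeasure_uniformOn Set.finite_univ Set.univ_nonempty

/-- Translation invariance is what makes the shifted queries of `pairCode` private. -/
theorem uniformOn_univ_preimage_add {G : Type*} [AddGroup G] [Finite G] [MeasurableSpace G]
    [MeasurableSingletonClass G] (s : Set G) (g : G) :
    uniformOn Set.univ ((fun x => x + g) ⁻¹' s) = uniformOn Set.univ s := by
  have := Fintype.ofFinite G
  rw [uniformOn_univ, uniformOn_univ, Measure.count_apply (Set.toFinite _).measurableSet,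
    Measure.count_apply (Set.toFinite _).measurableSet,
    Set.encard_preimage_of_bijective (AddGroup.addRight_bijective g)]

theorem iIndepFun_of_measurePreserving_pi {ι Ω : Type*} [Fintype ι] {A : ι → Type*}
    [MeasurableSpace Ω] [∀ i, MeasurableSpace (A i)] {μ : Measure Ω} {ν : ∀ i, Measure (A i)}
    [∀ i, IsProbabilityMeasure (ν i)] {φ : Ω → ∀ i, A i}
    (h : MeasurePreserving φ μ (Measure.pi ν)) : iIndepFun (fun i ω => φ ω i) μ := by
  have hi : ∀ i, MeasurePreserving (fun ω => φ ω i) μ (ν i) := fun i =>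
    (measurePreserving_eval ν i).comp h
  have : IsProbabilityMeasure μ := by
    have : IsProbabilityMeasure (μ.map φ) := by rw [h.map_eq]; infer_instance
    exact Measure.isProbabilityMeasure_of_map φ
  rw [iIndepFun_iff_map_fun_eq_pi_map fun i => (hi i).measurable.aemeasurable]
  simp_rw [fun i => (hi i).map_eq]
  exact h.map_eq

variable (M K : ℕ) {R : Type} [CommRing R] [Finite R] (e : X ≃ R)

/-- The code in which symbol `l` of every message is stored at the servers `l` and `l + 1` and is
retrieved from these two: server `l` is asked for a random linear combination of the symbols
with index `l`, and server `l + 1` for the same combination shifted by the requested symbol. -/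
noncomputable def pairCode : PIRCode (M + 2) K X :=
  letI : MeasurableSpace R := ⊤
  haveI : MeasurableSingletonClass R := ⟨fun _ => trivial⟩
  haveI := uniformOn_univ_isProbabilityMeasure X
  haveI := uniformOn_univ_isProbabilityMeasure (Fin (M + 2) → Fin K → R)
  { L := M + 2
    L_pos := Nat.succ_pos _
    Ω := (Fin K → Fin (M + 2) → X) × (Fin (M + 2) → Fin K → R)
    P := (Measure.pi fun _ => Measure.pi fun _ => uniformOn Set.univ).prod (uniformOn Set.univ)
    W := fun k l ω => ω.1 k l
    measurable_W := fun k l => by fun_prop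
    uniform_W := fun k l x => by
      have h := ((measurePreserving_eval (fun _ : Fin (M + 2) => uniformOn (Set.univ : Set X))
        l).comp (measurePreserving_eval (fun _ : Fin K => Measure.pi fun _ : Fin (M + 2) =>
          uniformOn (Set.univ : Set X)) k)).comp
        (measurePreserving_fst (ν := uniformOn (Set.univ : Set (Fin (M + 2) → Fin K → R))))
      have := Fintype.ofFinite X
      refine (h.measure_preimage (measurableSet_singleton x).nullMeasurableSet).trans ?_
      rw [uniformOn_univ, Measure.count_singleton, one_div, Nat.card_eq_fintype_card]
    indep_symbols := fun k => iIndepFun_of_measurePreserving_pi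
      ((measurePreserving_eval (fun _ : Fin K => Measure.pi fun _ : Fin (M + 2) =>
        uniformOn (Set.univ : Set X)) k).comp measurePreserving_fst)
    indep_messages := iIndepFun_of_measurePreserving_pi measurePreserving_fst
    Key := Fin (M + 2) → Fin K → R
    F := Prod.snd
    measurable_F := measurable_snd
    indep_key := (indepFun_prod measurable_id measurable_id).symm
    S := fun _ => (Fin K → X) × (Fin K → X)
    store := fun n w => (fun j => w j n, fun j => w j (n - 1))
    Q := fun _ => (Fin K → R) × (Fin K → R)
    query := fun k n f => (f n, f (n - 1) + Pi.single k 1)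
    measurable_query := fun k n q => (Set.toFinite _).measurableSet
    Y := X
    len := fun _ _ => 2
    answer := fun _ q s => ![e.symm (∑ j, q.1 j * e (s.1 j)), e.symm (∑ j, q.2 j * e (s.2 j))]
    -- Indices are cyclic: slot 1 of server `l + 1` refers to symbol `l`, with the coefficients of
    -- slot 0 of server `l` plus the unit vector at `k`, so the difference is the wanted symbol.
    decode := fun _ a l => e.symm (e ((a (l + 1)).2 1) - e ((a l).2 0))
    correct := fun k => ae_of_all _ fun ω => by
      funext l
      simp [add_mul, Finset.sum_add_distrib, Pi.single_apply]
    privacy := fun n k k' q => by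
      have hfun : ∀ s : Set (Fin (M + 2) → Fin K → R),
          ((Measure.pi fun _ : Fin K => Measure.pi fun _ : Fin (M + 2) =>
            uniformOn (Set.univ : Set X)).prod (uniformOn Set.univ)) (Prod.snd ⁻¹' s) =
            uniformOn Set.univ s := fun s =>
        measurePreserving_snd.measure_preimage (Set.toFinite _).measurableSet.nullMeasurableSet
      refine (hfun {f | (f n, f (n - 1) + Pi.single k 1) = q}).trans
        (Eq.trans ?_ (hfun {f | (f n, f (n - 1) + Pi.single k' 1) = q}).symm)
      -- This shift of the key turns the event for `k` into that for `k'`. It leaves `f n` alone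
      -- because n - 1 ≠ n modulo M + 2.
      rw [← uniformOn_univ_preimage_add _ (Pi.single (n - 1) (Pi.single k' 1 - Pi.single k 1))]
      congr 1
      ext f
      simp [add_assoc]
    integrable_len := fun k n => integrable_const _ }

theorem storageCost_pairCode :
    (pairCode X M K e).storageCost = 2 * pirAlpha0 (M + 2) K := by
  have hX : (1 : ℝ) < Nat.card X := by exact_mod_cast Finite.one_lt_card
  have h : ∀ n, Real.logb (Nat.card X) (Nat.card ((pairCode X M K e).S n)) = 2 * K := fun n => by
    change Real.logb (Nat.card X) (Nat.card ((Fin K → X) × (Fin K → X))) = 2 * K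
    rw [Nat.card_prod, Nat.card_fun, Nat.card_fin, ← pow_add, Nat.cast_pow, Real.logb_pow,
      Real.logb_self_eq_one hX]
    push_cast
    ring
  have hL : (pairCode X M K e).L = M + 2 := rfl
  rw [PIRCode.storageCost, hL]
  simp_rw [h]
  rw [Finset.sum_const, Finset.card_univ, Fintype.card_fin, nsmul_eq_mul, pirAlpha0]
  field_simp

theorem downloadCost_pairCode (k : Fin K) :
    (pairCode X M K e).downloadCost k = 2 / (M + 2 : ℕ) := by
  have hX : (1 : ℝ) < Nat.card X := by exact_mod_cast Finite.one_lt_card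
  have hL : (pairCode X M K e).L = M + 2 := rfl
  have hY : (pairCode X M K e).Y = X := rfl
  have hlen : ∀ n q, (pairCode X M K e).len n q = 2 := fun _ _ => rfl
  rw [PIRCode.downloadCost, hL, hY, Real.logb_self_eq_one hX]
  simp_rw [hlen]
  simp
  field_simp

theorem pirAchievable_two_mul (N K : ℕ) (hN : 2 ≤ N) (hK : 1 ≤ K) :
    PIRAchievable N K X (2 * pirAlpha0 N K) (2 * pirBeta0 N K) := by
  obtain ⟨M, rfl⟩ := Nat.exists_eq_add_of_le' hN
  have : NeZero (Nat.card X) := ⟨Nat.card_pos.ne'⟩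
  have : Finite (ZMod (Nat.card X)) := Nat.finite_of_card_ne_zero (by simp [Nat.card_pos.ne'])
  -- Any finite ring of size |X| works: the wanted symbol has coefficient 1, so no division is
  -- needed.
  obtain ⟨e⟩ : Nonempty (X ≃ ZMod (Nat.card X)) := Finite.card_eq.mp (Nat.card_zmod _).symm
  refine ⟨pairCode X M K e, (storageCost_pairCode X M K e).le, fun k => ?_⟩
  rw [downloadCost_pairCode, pirBeta0, ← mul_one_div]
  gcongr
  -- Only the first term 1/N of β₀ is needed.
  calc (1 : ℝ) / (M + 2 : ℕ) = ∑ i ∈ {1}, 1 / ((M + 2 : ℕ) : ℝ) ^ i := by simp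
    _ ≤ _ := Finset.sum_le_sum_of_subset_of_nonneg (by simpa using hK) fun _ _ _ => by positivity

end Achievability

/-! ### The three regimes. -/

theorem proposition1 (N K : ℕ) (hN : 2 ≤ N) (hK : 1 ≤ K)
    (X : Type) [Finite X] [Nontrivial X] [MeasurableSpace X] [MeasurableSingletonClass X] :
    PIRAchievable N K X (2 * pirAlpha0 N K) (2 * pirBeta0 N K) ∧
    (∀ α β : ℝ, PIRAchievable N K X α β → pirAlpha0 N K ≤ α ∧ pirBeta0 N K ≤ β) ∧
    (∀ β : ℝ, 2 * pirBeta0 N K ≤ β →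
      pirAlpha0 N K ≤ pirAlphaMin N K X β ∧ pirAlphaMin N K X β ≤ 2 * pirAlpha0 N K) ∧
    (∀ α : ℝ, 2 * pirAlpha0 N K ≤ α →
      pirBeta0 N K ≤ pirBetaMin N K X α ∧ pirBetaMin N K X α ≤ 2 * pirBeta0 N K) ∧
    (pirAlpha0 N K + pirBeta0 N K ≤
        sInf {s : ℝ | ∃ α β : ℝ, PIRAchievable N K X α β ∧
          α ≤ 2 * pirAlpha0 N K ∧ β ≤ 2 * pirBeta0 N K ∧ s = α + β} ∧
      sInf {s : ℝ | ∃ α β : ℝ, PIRAchievable N K X α β ∧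
          α ≤ 2 * pirAlpha0 N K ∧ β ≤ 2 * pirBeta0 N K ∧ s = α + β} ≤
        2 * pirAlpha0 N K + 2 * pirBeta0 N K) := by
  have hach := pirAchievable_two_mul X N K hN hK
  have hconv : ∀ α β : ℝ, PIRAchievable N K X α β → pirAlpha0 N K ≤ α ∧ pirBeta0 N K ≤ β := by
    rintro α β ⟨C, hα, hβ⟩
    exact ⟨(C.alpha0_le_storageCost (by omega)).trans hα,
      -- K ≥ 1 supplies a request; without one the download constraint would be vacuous.
      (C.beta0_le_downloadCost (by omega) ⟨0, hK⟩).trans (hβ _)⟩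
  refine ⟨hach, hconv, fun β hβ => ?_, fun α hα => ?_, ?_⟩
  -- The achievable point and the converse make the set nonempty and bounded below, so the real
  -- `sInf` is a genuine infimum.
  · have hmem : 2 * pirAlpha0 N K ∈ {α | PIRAchievable N K X α β} :=
      hach.imp fun C hC => ⟨hC.1, fun k => (hC.2 k).trans hβ⟩
    have hlb : pirAlpha0 N K ∈ lowerBounds {α | PIRAchievable N K X α β} :=
      fun α hα => (hconv α β hα).1
    exact ⟨le_csInf ⟨_, hmem⟩ hlb, csInf_le ⟨_, hlb⟩ hmem⟩
  · have hmem : 2 * pirBeta0 N K ∈ {β | PIRAchievable N K X α β} :=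
      hach.imp fun C hC => ⟨hC.1.trans hα, hC.2⟩
    have hlb : pirBeta0 N K ∈ lowerBounds {β | PIRAchievable N K X α β} :=
      fun β hβ => (hconv α β hβ).2
    exact ⟨le_csInf ⟨_, hmem⟩ hlb, csInf_le ⟨_, hlb⟩ hmem⟩
  · have hmem : 2 * pirAlpha0 N K + 2 * pirBeta0 N K ∈
        {s : ℝ | ∃ α β : ℝ, PIRAchievable N K X α β ∧
          α ≤ 2 * pirAlpha0 N K ∧ β ≤ 2 * pirBeta0 N K ∧ s = α + β} :=
      ⟨_, _, hach, le_rfl, le_rfl, rfl⟩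
    have hlb : pirAlpha0 N K + pirBeta0 N K ∈ lowerBounds
        {s : ℝ | ∃ α β : ℝ, PIRAchievable N K X α β ∧
          α ≤ 2 * pirAlpha0 N K ∧ β ≤ 2 * pirBeta0 N K ∧ s = α + β} := by
      rintro s ⟨α, β, h, -, -, rfl⟩
      exact add_le_add (hconv α β h).1 (hconv α β h).2
    exact ⟨le_csInf ⟨_, hmem⟩ hlb, csInf_le ⟨_, hlb⟩ hmem⟩
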